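/- **Setting.** Let $X_1,X_2,\dots$ be i.i.d. real random variables with law $P_X$ and $\mathsf E[X^2]=\sigma^2$, let $0<D_2<D_1<\sigma^2$ and $d(x^n,y^n)=\frac1n\sum_{i=1}^n(x_i-y_i)^2$. Given $(R_1,R_2)\in(0,\infty)^2$ put $$\lambda=\min\Big\{\frac{D_2e^{2R_2}}{D_1},1\Big\},\qquad P_Y=\sigma^2-\lambda D_1,\qquad P_Z=\lambda D_1-D_2 .$$ An $(n,M_1,M_2)$-code uses independent random codewords $Y^n(i)\sim\mathcal N(0,P_Y I_n)$, $i\in[M_1]$, independent of the source, and, given these, independent codewords $Z^n(i,j)\sim\mathcal N(Y^n(i),P_Z I_n)$, $j\in[M_2]$. The encoders are $f_1(X^n)=\arg\min_i d(X^n,Y^n(i))$ and $f_2(X^n)=\arg\min_j d(X^n,Z^n(f_1(X^n),j))$, and the decoders output $\hat X_1^n=Y^n(f_1(X^n))$ and $\hat X_2^n=Z^n(f_1(X^n),f_2(X^n))$. Put $\mathrm P^n_k=\Pr\{d(X^n,\hat X_k^n)>D_k\}$, $k=1,2$, the probability being over the source and the random codebooks. A pair $(E_1,E_2)$ of nonnegative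 reals is achievable if there is a sequence of $(n,M_1,M_2)$-codes with $$\limsup_n\tfrac1n\log M_1\le R_1,\quad \limsup_n\tfrac1n\log M_1M_2\le R_1+R_2,\quad \liminf_n-\tfrac1n\log\mathrm P^n_k\ge E_k\ (k=1,2);$$ $\mathcal E(D_1,D_2,R_1,R_2)$ is the closure of the convex hull of the set of achievable pairs. Let $$\Lambda^*_{X^2}(t)=\sup_{\theta\ge0}\{\theta t-\log\mathsf E[e^{\theta X^2}]\}\in[0,\infty],\qquad s^*(w,P,D)=\max\Big\{0,\frac{P-2D+\sqrt{P^2+4wD}}{4D}\Big\},$$ $$R_{\rm iid}(w,P,D)=\tfrac12\log(1+2s)+\frac{sw}{(1+2s)P}-\frac{sD}{P}\quad\text{with } s=s^*(w,P,D).$$ By the solution $\alpha$ of $R=R_{\rm iid}(\alpha,P,D)$ we mean the positive one; if there is none because $R<R_{\rm iid}(\beta,P,D)$ for all $\beta>0$, we put $\alpha=0$ (and then $\Lambda^*_{X^2}(\alpha)=0$). **Theorem.** Let $(R_1,R_2)\in(0,\infty)^2$ and let $\alpha_1^*$ be the solution of $R_1=R_{\rm iid}(\alpha,P_Y,D_1)$.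 (i) If $R_2\le\frac12\log\frac{D_1}{D_2}$, let $\alpha_2^*$ be the solution of $R_1=R_{\rm iid}(\alpha,P_Y,\lambda D_1)$. (ii) If $R_2>\frac12\log\frac{D_1}{D_2}$ (so that $\lambda=1$), let $\gamma^*>0$ be the solution of $R_2=R_{\rm iid}(\gamma,P_Z,D_2)$, and let $\alpha_2^*$ be the solution of $R_1=R_{\rm iid}(\alpha,P_Y,\gamma^*)$. In both cases $$\{(E_1,E_2)\in[0,\infty)^2:\ E_1\le\Lambda^*_{X^2}(\alpha_1^*),\ E_2\le\Lambda^*_{X^2}(\alpha_2^*)\}\subseteq\mathcal E(D_1,D_2,R_1,R_2).$$ -/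

import Mathlib

open MeasureTheory ProbabilityTheory Filter Topology

namespace SuccRef

noncomputable section

/-- The normalized quadratic distortion `d(x,y) = (1/n) ∑ (x_k - y_k)^2`. -/
def distortion {n : ℕ} (x y : Fin n → ℝ) : ℝ :=
  (∑ k, (x k - y k) ^ 2) / n

/-- The indices of the codewords of `c` at minimum distortion from `x`. -/
def argminSet {n M : ℕ} (x : Fin n → ℝ) (c : Fin M → Fin n → ℝ) : Finset (Fin M) :=
  Finset.univ.filter fun i => ∀ j, distortion x (c i) ≤ distortion x (c j)

theorem argminSet_nonempty {n M : ℕ} [NeZero M] (x : Fin n → ℝ) (c : Fin M → Fin n → ℝ) :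
    (argminSet x c).Nonempty := by
  obtain ⟨i, -, hi⟩ := Finset.exists_min_image Finset.univ (fun i => distortion x (c i))
    ⟨(0 : Fin M), Finset.mem_univ _⟩
  exact ⟨i, by simpa [argminSet] using fun j => hi j (Finset.mem_univ j)⟩

/-- Minimum Euclidean distance encoding: the index of a nearest codeword
(the least such index; for Gaussian codebooks ties have probability zero when `0 < n`). -/
def nearest {n M : ℕ} [NeZero M] (x : Fin n → ℝ) (c : Fin M → Fin n → ℝ) : Fin M :=
  (argminSet x c).min' (argminSet_nonempty x c)

/-- First encoder: `f₁(x) = argmin_i d(x, y(i))`. -/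
def enc₁ {n M₁ : ℕ} [NeZero M₁] (x : Fin n → ℝ) (y : Fin M₁ → Fin n → ℝ) : Fin M₁ :=
  nearest x y

/-- Second encoder: `f₂(x) = argmin_j d(x, z(f₁(x), j))`. -/
def enc₂ {n M₁ M₂ : ℕ} [NeZero M₁] [NeZero M₂] (x : Fin n → ℝ) (y : Fin M₁ → Fin n → ℝ)
    (z : Fin M₁ → Fin M₂ → Fin n → ℝ) : Fin M₂ :=
  nearest x (z (enc₁ x y))

/-- Output of the first decoder. -/
def dec₁ {n M₁ : ℕ} [NeZero M₁] (x : Fin n → ℝ) (y : Fin M₁ → Fin n → ℝ) : Fin n → ℝ :=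
  y (enc₁ x y)

/-- Output of the second decoder. -/
def dec₂ {n M₁ M₂ : ℕ} [NeZero M₁] [NeZero M₂] (x : Fin n → ℝ) (y : Fin M₁ → Fin n → ℝ)
    (z : Fin M₁ → Fin M₂ → Fin n → ℝ) : Fin n → ℝ :=
  z (enc₁ x y) (enc₂ x y z)

/-- The product Gaussian law with mean vector `c` and variance `P` in each component. -/
def iidLaw {n : ℕ} (c : Fin n → ℝ) (P : ℝ) : Measure (Fin n → ℝ) :=
  Measure.pi fun k => gaussianReal (c k) P.toNNReal

/-- Law of the first codebook: `M₁` independent codewords `Y(i) ~ f_iid(· | 0, P_Y)`. -/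
def codebook₁ (n M₁ : ℕ) (PY : ℝ) : Measure (Fin M₁ → Fin n → ℝ) :=
  Measure.pi fun _ => iidLaw 0 PY

/-- Law of the second codebook given the first one: independent codewords
`Z(i,j) ~ f_iid(· | Y(i), P_Z)`. -/
def codebook₂ {n M₁ : ℕ} (M₂ : ℕ) (PZ : ℝ) (y : Fin M₁ → Fin n → ℝ) :
    Measure (Fin M₁ → Fin M₂ → Fin n → ℝ) :=
  Measure.pi fun i => Measure.pi fun _ => iidLaw (y i) PZ

/-- Ensemble probability of an event in (source sequence, first codebook, second codebook):
the source sequence is i.i.d. with law `PX` and independent of the random codebooks. -/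
def ensemblePr (PX : Measure ℝ) (n M₁ M₂ : ℕ) (PY PZ : ℝ)
    (A : Set ((Fin n → ℝ) × (Fin M₁ → Fin n → ℝ) × (Fin M₁ → Fin M₂ → Fin n → ℝ))) : ENNReal :=
  ∫⁻ x, ∫⁻ y, codebook₂ M₂ PZ y {z | (x, y, z) ∈ A} ∂(codebook₁ n M₁ PY)
    ∂(Measure.pi fun _ : Fin n => PX)

/-- Ensemble excess-distortion probability of the first decoder. -/
def excessPr₁ (PX : Measure ℝ) (PY PZ D₁ : ℝ) (n M₁ M₂ : ℕ) [NeZero M₁] : ENNReal :=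
  ensemblePr PX n M₁ M₂ PY PZ {t | D₁ < distortion t.1 (dec₁ t.1 t.2.1)}

/-- Ensemble excess-distortion probability of the second decoder. -/
def excessPr₂ (PX : Measure ℝ) (PY PZ D₂ : ℝ) (n M₁ M₂ : ℕ) [NeZero M₁] [NeZero M₂] : ENNReal :=
  ensemblePr PX n M₁ M₂ PY PZ {t | D₂ < distortion t.1 (dec₂ t.1 t.2.1 t.2.2)}

/-- The exponent `liminf_n -(1/n) log p_n`, in the extended reals (`log 0 = -∞`). -/
def decayExponent (p : ℕ → ENNReal) : EReal :=
  liminf (fun n : ℕ => -(ENNReal.log (p n)) / (n : EReal)) atTop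

/-- Codeword power of the first codebook with design parameter `lam`. -/
def powerY (σ lam D₁ : ℝ) : ℝ := σ ^ 2 - lam * D₁

/-- Codeword power of the second codebook with design parameter `lam`. -/
def powerZ (lam D₁ D₂ : ℝ) : ℝ := lam * D₁ - D₂

/-- The pairs of exponents that are achievable under separate excess-distortion probabilities
with i.i.d. Gaussian codebooks of design parameter `lam`. -/
def achievableExponents (PX : Measure ℝ) (σ lam D₁ D₂ R₁ R₂ : ℝ) : Set (ℝ × ℝ) :=
  {E | 0 ≤ E.1 ∧ 0 ≤ E.2 ∧ ∃ M₁ M₂ : ℕ → ℕ+,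
    limsup (fun n : ℕ => ((Real.log (M₁ n : ℕ) / n : ℝ) : EReal)) atTop ≤ (R₁ : EReal) ∧
    limsup (fun n : ℕ => ((Real.log ((M₁ n : ℕ) * (M₂ n : ℕ)) / n : ℝ) : EReal)) atTop
      ≤ ((R₁ + R₂ : ℝ) : EReal) ∧
    (E.1 : EReal) ≤ decayExponent (fun n =>
      excessPr₁ PX (powerY σ lam D₁) (powerZ lam D₁ D₂) D₁ n (M₁ n) (M₂ n)) ∧
    (E.2 : EReal) ≤ decayExponent (fun n =>
      excessPr₂ PX (powerY σ lam D₁) (powerZ lam D₁ D₂) D₂ n (M₁ n) (M₂ n))}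

/-- The exponent region: the convex closure of the set of achievable pairs. -/
def exponentRegion (PX : Measure ℝ) (σ lam D₁ D₂ R₁ R₂ : ℝ) : Set (ℝ × ℝ) :=
  closure (convexHull ℝ (achievableExponents PX σ lam D₁ D₂ R₁ R₂))

/-- Cumulant generating function `log E[exp(θ X)]`, with value `+∞` where the expectation is
infinite. -/
def cumulant {Ω : Type*} [MeasurableSpace Ω] (μ : Measure Ω) (X : Ω → ℝ) (θ : ℝ) : EReal :=
  ENNReal.log (∫⁻ ω, ENNReal.ofReal (Real.exp (θ * X ω)) ∂μ)

/-- Fenchel-Legendre transform `sup_{θ ≥ 0} (θ t - log E[exp(θ X)])`. -/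
def rateFn {Ω : Type*} [MeasurableSpace Ω] (μ : Measure Ω) (X : Ω → ℝ) (t : ℝ) : EReal :=
  ⨆ θ : ℝ, ⨆ _ : 0 ≤ θ, ((θ * t : ℝ) : EReal) - cumulant μ X θ

/-- The four-argument function `R_iid(s,w,P,D)`. -/
def RiidAt (s w P D : ℝ) : ℝ :=
  1 / 2 * Real.log (1 + 2 * s) + s * w / ((1 + 2 * s) * P) - s * D / P

/-- `s*(w,P,D)`. -/
def sStar (w P D : ℝ) : ℝ :=
  max 0 ((P - 2 * D + Real.sqrt (P ^ 2 + 4 * w * D)) / (4 * D))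

/-- The three-argument function `R_iid(w,P,D)`. -/
def Riid (w P D : ℝ) : ℝ := RiidAt (sStar w P D) w P D

/-- `α` is the solution of `R = R_iid(α,P,D)` among positive reals. If `R` lies below all
the values `R_iid(β,P,D)`, `β > 0`, so that there is no solution, then `α = 0`. -/
def IsPowerSolution (R P D α : ℝ) : Prop :=
  (0 < α ∧ R = Riid α P D) ∨ (α = 0 ∧ ∀ β : ℝ, 0 < β → R < Riid β P D)

/-- The nonnegative exponent pairs `(E₁,E₂)` with `E₁ ≤ Λ*_{X²}(α₁)` and `E₂ ≤ Λ*_{X²}(α₂)`. -/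
def exponentsUpTo (PX : Measure ℝ) (α₁ α₂ : ℝ) : Set (ℝ × ℝ) :=
  {E | 0 ≤ E.1 ∧ 0 ≤ E.2 ∧ (E.1 : EReal) ≤ rateFn PX (fun x => x ^ 2) α₁ ∧
    (E.2 : EReal) ≤ rateFn PX (fun x => x ^ 2) α₂}

/-- The design parameter `min {D₂ exp(2 R₂) / D₁, 1}`. -/
def designParam (D₁ D₂ R₂ : ℝ) : ℝ := min (D₂ * Real.exp (2 * R₂) / D₁) 1

end

end SuccRef

namespace SuccRef

/-! ### The rate function `R_iid` -/

/-! Each layer rests on one estimate. For a codeword `y ~ N(c, P I)` and a centre `x` with `d(x, c)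
≤ w`, the ball `d(x, y) ≤ D` has probability at least `exp(-n r) / 2` for some `r < R`, once `n` is
large, provided `R_iid(w, P, D) < R`. Tilting the codeword law by `exp(-(s/P)(x - y)²)` keeps it
Gaussian, and `s*` puts the tilted mean distortion at the target, or below it when `s* = 0`. The
weak law gives a thin shell of distortions tilted mass at least 1/2, and on it the density is
`exp(-n R_iid(s, ...))` (`eventually_le_iidLaw_ball`). Hence `exp(n R)` independent codewords all
miss with superexponentially small probability (`eventually_iidLaw_miss_pow_le`).

Only the power of the source remains. If `w < α`, strict monotonicity gives `R_iid(w) < R`, so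
failure requires power above `w`, up to superexponentially small terms, and Chernoff's bound with
`w` close to `α` yields the exponent `Λ*(α)`.

The estimate is uniform in `x` and `c`, so it also serves the second layer, centred at the chosen
first codeword. That layer succeeds when the first comes within some `γ' < γ`, where `R₂ = R_iid(γ,
P_Z, D₂)`. In case (i), `λ` is such that `γ = λ D₁` solves this equation, so both cases reduce to
`exponentsUpTo_subset_exponentRegion`. -/

theorem sStar_nonneg (w P D : ℝ) : 0 ≤ sStar w P D := le_max_left _ _

theorem sStar_mono {w w' P D : ℝ} (hD : 0 < D) (h : w ≤ w') : sStar w P D ≤ sStar w' P D := by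
  unfold sStar
  gcongr

/-- With `u = 1 + 2s` the equation is `D u² - P u - w = 0`, whose larger root defines `sStar`. For
`w = d(x, c)` the left side is the mean distortion under the tilted codeword law. -/
theorem tilted_mean_eq {w P D : ℝ} (hD : 0 < D) (hw : 0 ≤ w) (hs : 0 < sStar w P D) :
    P / (1 + 2 * sStar w P D) + w / (1 + 2 * sStar w P D) ^ 2 = D := by
  have h0 : sStar w P D = (P - 2 * D + √(P ^ 2 + 4 * w * D)) / (4 * D) := by
    unfold sStar at hs ⊢
    rcases lt_max_iff.1 hs with h | h
    · exact absurd h (lt_irrefl _)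
    · exact max_eq_right h.le
  have hq : √(P ^ 2 + 4 * w * D) ^ 2 = P ^ 2 + 4 * w * D := Real.sq_sqrt (by positivity)
  have hu : 1 + 2 * sStar w P D = (P + √(P ^ 2 + 4 * w * D)) / (2 * D) := by
    rw [h0]; field_simp; ring
  have hpos : 0 < 1 + 2 * sStar w P D := by linarith
  rw [hu] at hpos ⊢
  have hr : 0 < P + √(P ^ 2 + 4 * w * D) := by
    by_contra hcon
    exact absurd (div_nonpos_of_nonpos_of_nonneg (not_lt.1 hcon) (by positivity)) (not_le.2 hpos)
  set q := √(P ^ 2 + 4 * w * D)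
  field_simp
  nlinarith

theorem tilted_mean_le {w P D : ℝ} (hD : 0 < D) (hw : 0 ≤ w) :
    P / (1 + 2 * sStar w P D) + w / (1 + 2 * sStar w P D) ^ 2 ≤ D := by
  rcases (sStar_nonneg w P D).eq_or_lt with hs | hs
  · rw [← hs]
    have h1 : (P - 2 * D + √(P ^ 2 + 4 * w * D)) / (4 * D) ≤ 0 := by
      have := le_max_right 0 ((P - 2 * D + √(P ^ 2 + 4 * w * D)) / (4 * D))
      unfold sStar at hs
      linarith
    have h2 : √(P ^ 2 + 4 * w * D) ≤ 2 * D - P := by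
      by_contra hcon
      exact absurd h1 (not_le.2 (div_pos (by linarith) (by linarith)))
    have h3 : 0 ≤ 2 * D - P := (Real.sqrt_nonneg _).trans h2
    have h4 := (Real.sqrt_le_left h3).1 h2
    have : w * D ≤ (D - P) * D := by nlinarith
    have := le_of_mul_le_mul_right this hD
    norm_num
    linarith
  · exact (tilted_mean_eq hD hw hs).le

/-- `RiidAt` is concave in `s`, with derivative `(P/(1+2s) + w/(1+2s)² - D)/P`, so `sStar` is its
maximiser on `s ≥ 0`. Both concave terms are bounded by their tangents at `sStar`. Thus `Riid` is a
maximum of functions that increase with `w`. -/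
theorem RiidAt_le_Riid {s w P D : ℝ} (hs : 0 ≤ s) (hw : 0 ≤ w) (hP : 0 < P) (hD : 0 < D) :
    RiidAt s w P D ≤ Riid w P D := by
  unfold Riid RiidAt
  have hle := tilted_mean_le (P := P) hD hw
  have heq := tilted_mean_eq (P := P) hD hw
  have h0 := sStar_nonneg w P D
  generalize sStar w P D = r at *
  have hu : 0 < 1 + 2 * s := by linarith
  have hv : 0 < 1 + 2 * r := by linarith
  have hlog : Real.log (1 + 2 * s) ≤ Real.log (1 + 2 * r) + (2 * s - 2 * r) / (1 + 2 * r) := by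
    have := Real.log_le_sub_one_of_pos (div_pos hu hv)
    rw [Real.log_div hu.ne' hv.ne'] at this
    have e : (1 + 2 * s) / (1 + 2 * r) - 1 = (2 * s - 2 * r) / (1 + 2 * r) := by
      field_simp
      ring
    linarith
  have hfrac : s / (1 + 2 * s) ≤ r / (1 + 2 * r) + (s - r) / (1 + 2 * r) ^ 2 := by
    have e : r / (1 + 2 * r) + (s - r) / (1 + 2 * r) ^ 2 - s / (1 + 2 * s)
        = 2 * (s - r) ^ 2 / ((1 + 2 * r) ^ 2 * (1 + 2 * s)) := by
      field_simp; ring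
    have : 0 ≤ 2 * (s - r) ^ 2 / ((1 + 2 * r) ^ 2 * (1 + 2 * s)) := by positivity
    linarith
  have hfrac' := mul_le_mul_of_nonneg_right hfrac (div_nonneg hw hP.le)
  -- First-order condition at the maximiser: the slope vanishes if `r > 0`, and is nonpositive if `r
  -- = 0`.
  have key : (s - r) * (P / (1 + 2 * r) + w / (1 + 2 * r) ^ 2 - D) ≤ 0 := by
    rcases h0.eq_or_lt with h | h
    · subst h
      exact mul_nonpos_of_nonneg_of_nonpos (by linarith) (by linarith)
    · rw [heq h]; simp
  have key' : (s - r) * (P / (1 + 2 * r) + w / (1 + 2 * r) ^ 2 - D) / P ≤ 0 :=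
    div_nonpos_of_nonpos_of_nonneg key hP.le
  have e1 : (s - r) * (P / (1 + 2 * r) + w / (1 + 2 * r) ^ 2 - D) / P
      = 1 / 2 * ((2 * s - 2 * r) / (1 + 2 * r)) + (s - r) / (1 + 2 * r) ^ 2 * (w / P)
        - (s * D / P - r * D / P) := by
    field_simp
  have e2 : s * w / ((1 + 2 * s) * P) = s / (1 + 2 * s) * (w / P) := by field_simp
  have e3 : r * w / ((1 + 2 * r) * P) = r / (1 + 2 * r) * (w / P) := by field_simp
  rw [e2, e3]
  nlinarith

theorem RiidAt_mono {s w w' P D : ℝ} (hs : 0 ≤ s) (hP : 0 < P) (h : w ≤ w') :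
    RiidAt s w P D ≤ RiidAt s w' P D := by
  unfold RiidAt
  gcongr

theorem Riid_mono {w w' P D : ℝ} (hw : 0 ≤ w) (hP : 0 < P) (hD : 0 < D) (h : w ≤ w') :
    Riid w P D ≤ Riid w' P D :=
  (RiidAt_mono (sStar_nonneg _ _ _) hP h).trans
    (RiidAt_le_Riid (sStar_nonneg _ _ _) (hw.trans h) hP hD)

/-- Where `sStar` vanishes, `Riid` is `0 < R`. Otherwise the maximiser for `w` already gives a
strictly larger value at `w'`. -/
theorem Riid_lt_of_lt {R w w' P D : ℝ} (hR : 0 < R) (hw : 0 ≤ w) (hP : 0 < P) (hD : 0 < D)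
    (h : w < w') (hw' : R = Riid w' P D) : Riid w P D < R := by
  rcases (sStar_nonneg w P D).eq_or_lt with hs | hs
  · unfold Riid RiidAt
    rw [← hs]
    simpa using hR
  · rw [hw']
    refine lt_of_lt_of_le ?_ (RiidAt_le_Riid (sStar_nonneg w P D) (hw.trans h.le) hP hD)
    unfold Riid RiidAt
    gcongr

/-- At `w = P + D` the discriminant is a perfect square and the last two terms of `RiidAt` cancel,
leaving the Gaussian rate-distortion function. This evaluates `R_iid(γ, P_Z, D₂)` in case (i). -/
theorem Riid_add_self {P D : ℝ} (hP : 0 < P) (hD : 0 < D) :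
    Riid (P + D) P D = 1 / 2 * Real.log ((P + D) / D) := by
  have hs : sStar (P + D) P D = P / (2 * D) := by
    unfold sStar
    have : P ^ 2 + 4 * (P + D) * D = (P + 2 * D) ^ 2 := by ring
    rw [this, Real.sqrt_sq (by positivity), max_eq_right]
    · field_simp; ring
    · apply div_nonneg <;> linarith
  unfold Riid RiidAt
  rw [hs]
  have : 1 + 2 * (P / (2 * D)) = (P + D) / D := by field_simp; ring
  rw [this]
  field_simp
  ring

theorem continuousAt_sStar {w P D : ℝ} (hD : D ≠ 0) :
    ContinuousAt (fun D => sStar w P D) D := by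
  unfold sStar
  exact continuousAt_const.max (ContinuousAt.div (by fun_prop) (by fun_prop) (by positivity))

theorem continuousAt_Riid {w P D : ℝ} (hP : 0 < P) (hD : D ≠ 0) :
    ContinuousAt (fun D => Riid w P D) D := by
  unfold Riid RiidAt
  have hs := continuousAt_sStar (w := w) (P := P) hD
  have h0 : 0 < 1 + 2 * sStar w P D := by linarith [sStar_nonneg w P D]
  have h1 : ContinuousAt (fun D => 1 + 2 * sStar w P D) D :=
    continuousAt_const.add (continuousAt_const.mul hs)
  refine ((continuousAt_const.mul (h1.log h0.ne')).add ?_).sub ?_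
  · exact (hs.mul continuousAt_const).div (h1.mul continuousAt_const) (by positivity)
  · exact (hs.mul continuousAt_id).div_const P

/-- If `R` exceeds `R_iid(w,P,D)`, it still exceeds it after a small decrease of the target
distortion, with room for the change of measure. -/
theorem exists_slack {R w P D : ℝ} (hP : 0 < P) (hD : 0 < D) (h : Riid w P D < R) :
    ∃ δ, 0 < δ ∧ 2 * δ < D ∧ Riid w P (D - δ) + sStar w P (D - δ) * δ / P < R := by
  have hc : ContinuousAt (fun δ : ℝ => Riid w P (D - δ) + sStar w P (D - δ) * δ / P) 0 := by
    have hsub : ContinuousAt (fun δ : ℝ => D - δ) 0 := by fun_prop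
    have h1 : ContinuousAt (fun δ : ℝ => Riid w P (D - δ)) 0 :=
      ContinuousAt.comp (f := fun δ : ℝ => D - δ) (g := fun D => Riid w P D)
        (by simpa using continuousAt_Riid hP hD.ne') hsub
    have h2 : ContinuousAt (fun δ : ℝ => sStar w P (D - δ)) 0 :=
      ContinuousAt.comp (f := fun δ : ℝ => D - δ) (g := fun D => sStar w P D)
        (by simpa using continuousAt_sStar hD.ne') hsub
    exact h1.add ((h2.mul continuousAt_id).div_const P)
  have hev := hc.eventually_lt continuousAt_const (by simpa using h)
  have h3 : ∀ᶠ δ : ℝ in 𝓝[>] 0, 2 * δ < D := by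
    refine Filter.Eventually.filter_mono nhdsWithin_le_nhds ?_
    filter_upwards [gt_mem_nhds (show (0 : ℝ) < D / 2 by positivity)] with δ hδ
    linarith
  obtain ⟨δ, h1, h2, h4⟩ := ((hev.filter_mono nhdsWithin_le_nhds).and
    (h3.and (self_mem_nhdsWithin (s := Set.Ioi (0 : ℝ))))).exists
  exact ⟨δ, h4, h2, h1⟩

/-- If `R` exceeds `R_iid(w,P,D)`, it still exceeds it for some smaller distortion. -/
theorem exists_lt_distortion {R w P D : ℝ} (hP : 0 < P) (hD : 0 < D) (h : Riid w P D < R) :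
    ∃ D', 0 < D' ∧ D' < D ∧ Riid w P D' < R := by
  obtain ⟨δ, h0, h1, h2⟩ := exists_slack hP hD h
  refine ⟨D - δ, by linarith, by linarith, lt_of_le_of_lt ?_ h2⟩
  have := sStar_nonneg w P (D - δ)
  have : 0 ≤ sStar w P (D - δ) * δ / P := by positivity
  linarith

/-! ### Probability of a distortion ball under a Gaussian codeword law -/

theorem lintegral_pi_prod {ι : Type*} [Fintype ι] {Ω : ι → Type*}
    [∀ i, MeasurableSpace (Ω i)] (μ : ∀ i, Measure (Ω i)) [∀ i, IsProbabilityMeasure (μ i)]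
    {f : ∀ i, Ω i → ENNReal} (hf : ∀ i, Measurable (f i)) :
    ∫⁻ x, ∏ i, f i (x i) ∂(Measure.pi μ) = ∏ i, ∫⁻ x, f i x ∂(μ i) := by
  have hind : iIndepFun (fun i (x : ∀ i, Ω i) => f i (x i)) (Measure.pi μ) :=
    iIndepFun_pi fun i => (hf i).aemeasurable
  have := lintegral_prod_eq_prod_lintegral_of_indepFun Finset.univ
    (fun i (x : ∀ i, Ω i) => f i (x i)) hind
    (fun i => (hf i).comp (measurable_pi_apply i))
  rw [this]
  refine Finset.prod_congr rfl fun i _ => ?_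
  exact (measurePreserving_eval μ i).lintegral_comp (hf i)

theorem pi_withDensity {ι : Type*} [Fintype ι] {Ω : ι → Type*}
    [∀ i, MeasurableSpace (Ω i)] (μ : ∀ i, Measure (Ω i)) [∀ i, IsProbabilityMeasure (μ i)]
    {f : ∀ i, Ω i → ENNReal} (hf : ∀ i, Measurable (f i))
    [∀ i, SigmaFinite ((μ i).withDensity (f i))] :
    Measure.pi (fun i => (μ i).withDensity (f i))
      = (Measure.pi μ).withDensity (fun x => ∏ i, f i (x i)) := by
  refine (Measure.pi_eq fun s hs => ?_)
  rw [withDensity_apply _ (MeasurableSet.univ_pi hs), ← lintegral_indicator (MeasurableSet.univ_pi hs)]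
  have : (Set.univ.pi s).indicator (fun x => ∏ i, f i (x i))
      = fun x => ∏ i, (s i).indicator (f i) (x i) := by
    funext x
    by_cases hx : x ∈ Set.univ.pi s
    · rw [Set.indicator_of_mem hx]
      exact Finset.prod_congr rfl fun i _ => (Set.indicator_of_mem (hx i trivial) _).symm
    · rw [Set.indicator_of_notMem hx]
      simp only [Set.mem_pi, Set.mem_univ, true_imp_iff, not_forall] at hx
      obtain ⟨i, hi⟩ := hx
      exact (Finset.prod_eq_zero (Finset.mem_univ i) (Set.indicator_of_notMem hi _)).symm
  rw [this, lintegral_pi_prod μ fun i => (hf i).indicator (hs i)]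
  refine Finset.prod_congr rfl fun i _ => ?_
  rw [withDensity_apply _ (hs i), lintegral_indicator (hs i)]

/-- The density of `N(c, P)` with respect to its tilt by `exp (-(s / P) (y - x)^2)`, which is again
Gaussian. -/
noncomputable def tiltDensity (s P x c y : ℝ) : ℝ :=
  Real.exp (-(1 / 2 * Real.log (1 + 2 * s) + s / ((1 + 2 * s) * P) * (x - c) ^ 2
    - s / P * (x - y) ^ 2))

/-- Completing the square: `(y - c)²/(2P) + s(x - y)²/P` has its minimum `s(x - c)²/((1 + 2s)P)` at
`y = x - (x - c)/(1 + 2s)`, with curvature `(1 + 2s)/P`. -/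
theorem gaussianPDFReal_eq_tilt {s P : ℝ} (hs : 0 ≤ s) (hP : 0 < P) (x c y : ℝ) :
    gaussianPDFReal c P.toNNReal y
      = gaussianPDFReal (x - (x - c) / (1 + 2 * s)) (P / (1 + 2 * s)).toNNReal y
        * tiltDensity s P x c y := by
  have hu : 0 < 1 + 2 * s := by linarith
  have hQ : 0 < P / (1 + 2 * s) := by positivity
  unfold gaussianPDFReal tiltDensity
  rw [Real.coe_toNNReal _ hP.le, Real.coe_toNNReal _ hQ.le]
  have h1 : √(2 * Real.pi * (P / (1 + 2 * s))) = √(2 * Real.pi * P) / √(1 + 2 * s) := by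
    rw [← mul_div_assoc, Real.sqrt_div' _ hu.le]
  have h2 : √(1 + 2 * s) = Real.exp (1 / 2 * Real.log (1 + 2 * s)) := by
    rw [Real.sqrt_eq_rpow, Real.rpow_def_of_pos hu, mul_comm]
  rw [h1, h2, inv_div, div_eq_mul_inv (Real.exp _), mul_comm (Real.exp _),
    mul_assoc _ (Real.exp _) (Real.exp _), mul_assoc _ (Real.exp _) (Real.exp _ * Real.exp _),
    ← Real.exp_add, ← Real.exp_add]
  congr 2
  field_simp
  ring

theorem gaussianReal_eq_tilt {s P : ℝ} (hs : 0 ≤ s) (hP : 0 < P) (x c : ℝ) :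
    gaussianReal c P.toNNReal
      = (gaussianReal (x - (x - c) / (1 + 2 * s)) (P / (1 + 2 * s)).toNNReal).withDensity
        (fun y => ENNReal.ofReal (tiltDensity s P x c y)) := by
  have hu : 0 < 1 + 2 * s := by linarith
  have hQ : 0 < P / (1 + 2 * s) := by positivity
  have hm : Measurable (fun y => ENNReal.ofReal (tiltDensity s P x c y)) := by
    unfold tiltDensity; fun_prop
  rw [gaussianReal_of_var_ne_zero _ (by simpa using hP),
    gaussianReal_of_var_ne_zero _ (by simpa using hQ),
    ← withDensity_mul _ (measurable_gaussianPDF _ _) hm]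
  congr 1
  funext y
  simp only [Pi.mul_apply, gaussianPDF]
  rw [← ENNReal.ofReal_mul (gaussianPDFReal_nonneg _ _ _), ← gaussianPDFReal_eq_tilt hs hP]

instance {n : ℕ} (c : Fin n → ℝ) (P : ℝ) : IsProbabilityMeasure (iidLaw c P) := by
  unfold iidLaw; infer_instance

theorem iidLaw_eq_tilt {n : ℕ} {s P : ℝ} (hs : 0 ≤ s) (hP : 0 < P) (x c : Fin n → ℝ) :
    iidLaw c P = (iidLaw (fun k => x k - (x k - c k) / (1 + 2 * s)) (P / (1 + 2 * s))).withDensity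
      (fun y => ∏ k, ENNReal.ofReal (tiltDensity s P (x k) (c k) (y k))) := by
  have : ∀ k, SigmaFinite ((gaussianReal (x k - (x k - c k) / (1 + 2 * s))
      (P / (1 + 2 * s)).toNNReal).withDensity
        (fun y => ENNReal.ofReal (tiltDensity s P (x k) (c k) y))) := fun k => by
    rw [← gaussianReal_eq_tilt hs hP]; infer_instance
  unfold iidLaw
  rw [← pi_withDensity (fun k => gaussianReal (x k - (x k - c k) / (1 + 2 * s))
    (P / (1 + 2 * s)).toNNReal) (f := fun k y => ENNReal.ofReal (tiltDensity s P (x k) (c k) y))]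
  · congr 1
    funext k
    exact gaussianReal_eq_tilt hs hP _ _
  · intro k
    unfold tiltDensity; fun_prop

theorem distortion_nonneg {n : ℕ} (x y : Fin n → ℝ) : 0 ≤ distortion x y := by
  unfold distortion; positivity

theorem measurable_distortion_right {n : ℕ} (x : Fin n → ℝ) : Measurable (distortion x) := by
  unfold distortion; fun_prop

/-- The exponent is affine in `(x - c)²` and `(x - y)²`, so the product sees the vectors only
through two distortions. This makes bounds uniform in `x` and `c` possible. -/
theorem prod_tiltDensity {n : ℕ} (hn : n ≠ 0) {s P : ℝ} (x c y : Fin n → ℝ) :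
    ∏ k, ENNReal.ofReal (tiltDensity s P (x k) (c k) (y k))
      = ENNReal.ofReal (Real.exp (-(n * RiidAt s (distortion x c) P (distortion x y)))) := by
  have hn' : (n : ℝ) ≠ 0 := by exact_mod_cast hn
  rw [← ENNReal.ofReal_prod_of_nonneg fun k _ => by unfold tiltDensity; positivity]
  unfold tiltDensity
  rw [← Real.exp_sum, Finset.sum_neg_distrib, Finset.sum_sub_distrib, Finset.sum_add_distrib,
    Finset.sum_const, ← Finset.mul_sum, ← Finset.mul_sum]
  congr 3
  unfold RiidAt distortion
  simp only [Finset.card_univ, Fintype.card_fin, nsmul_eq_mul]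
  field_simp

theorem integrable_pow_gaussianReal (m : ℝ) (v : NNReal) (k : ℕ) :
    Integrable (fun g : ℝ => g ^ k) (gaussianReal m v) :=
  (memLp_id_gaussianReal' (μ := m) (v := v) (k : ENNReal) (by simp)).integrable_norm_pow'.mono'
    (by fun_prop) (by simp)

theorem memLp_sq_sub_gaussianReal (x m : ℝ) (v : NNReal) :
    MemLp (fun y : ℝ => (x - y) ^ 2) 2 (gaussianReal m v) := by
  rw [memLp_two_iff_integrable_sq (by fun_prop)]
  have h : (fun y : ℝ => ((x - y) ^ 2) ^ 2) = fun y => x ^ 4 * y ^ 0 - 4 * x ^ 3 * y ^ 1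
      + 6 * x ^ 2 * y ^ 2 - 4 * x * y ^ 3 + 1 * y ^ 4 := by
    funext y; ring
  rw [h]
  have := integrable_pow_gaussianReal m v
  exact (((((this 0).const_mul _).sub ((this 1).const_mul _)).add ((this 2).const_mul _)).sub
    ((this 3).const_mul _)).add ((this 4).const_mul _)

theorem integral_sq_sub_gaussianReal (x m : ℝ) (v : NNReal) :
    ∫ y, (x - y) ^ 2 ∂gaussianReal m v = v + (x - m) ^ 2 := by
  have h2 : ∫ y, y ^ 2 ∂gaussianReal m v = v + m ^ 2 := by
    have := variance_fun_id_gaussianReal (μ := m) (v := v)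
    rw [variance_eq_sub (X := fun y : ℝ => y) (memLp_id_gaussianReal' 2 (by simp))] at this
    simp only [Pi.pow_apply, integral_id_gaussianReal] at this
    linarith
  have h : (fun y : ℝ => (x - y) ^ 2) = fun y => (x ^ 2 - 2 * x * y) + y ^ 2 := by
    funext y; ring
  have i1 : Integrable (fun y : ℝ => y) (gaussianReal m v) := by
    simpa using integrable_pow_gaussianReal m v 1
  have i3 : Integrable (fun y : ℝ => x ^ 2 - 2 * x * y) (gaussianReal m v) :=
    (integrable_const _).sub (i1.const_mul _)
  rw [h, integral_add i3 (integrable_pow_gaussianReal m v 2),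
    integral_sub (integrable_const _) (i1.const_mul _),
    integral_const_mul, integral_id_gaussianReal, h2]
  simp
  ring

theorem exists_variance_sq_sub_le : ∃ C : ℝ, 0 ≤ C ∧ ∀ (x m : ℝ) (v : NNReal),
    Var[fun y => (x - y) ^ 2; gaussianReal m v] ≤ C * ((v : ℝ) ^ 2 + v * (x - m) ^ 2) := by
  set K := ∫ g, g ^ 4 ∂gaussianReal 0 1 with hK
  have hK0 : 0 ≤ K := integral_nonneg fun g => by positivity
  refine ⟨8 + 2 * K, by positivity, fun x m v => ?_⟩
  -- Writing `y = √v g + m` with `g` standard normal makes the constant independent of `x`, `m` and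
  -- `v`.
  have hmap : (gaussianReal 0 1).map (fun g => √v * g + m) = gaussianReal m v := by
    have h1 : (fun g : ℝ => √v * g + m) = (fun g => g + m) ∘ (fun g => √v * g) := rfl
    rw [h1, ← Measure.map_map (by fun_prop) (by fun_prop), gaussianReal_map_const_mul,
      gaussianReal_map_add_const]
    congr 1
    · simp
    · ext; simp
  rw [← hmap, variance_map (by fun_prop) (by fun_prop)]
  set a := x - m
  have hsq : √(v : ℝ) ^ 2 = v := Real.sq_sqrt v.2
  have hfun : ((fun y : ℝ => (x - y) ^ 2) ∘ fun g => √v * g + m)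
      = fun g => (v * g ^ 2 - 2 * a * √v * g) + a ^ 2 := by
    funext g
    simp only [Function.comp, a]
    linear_combination (g ^ 2) * hsq
  have i2 := integrable_pow_gaussianReal 0 1 2
  have i4 := integrable_pow_gaussianReal 0 1 4
  have e2 : ∫ g, g ^ 2 ∂gaussianReal 0 1 = 1 := by
    simpa using integral_sq_sub_gaussianReal 0 0 1
  rw [hfun, variance_add_const (by fun_prop)]
  refine (variance_le_expectation_sq (by fun_prop)).trans ?_
  have hint : Integrable (fun g : ℝ => 8 * a ^ 2 * v * g ^ 2 + 2 * (v : ℝ) ^ 2 * g ^ 4)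
      (gaussianReal 0 1) := (i2.const_mul _).add (i4.const_mul _)
  -- The inequality `(p - q)² ≤ 2p² + 2q²` with `p = v g²`, `q = 2a√v g` is the source of `8` and
  -- `2K`.
  refine (integral_mono_of_nonneg (ae_of_all _ fun g => sq_nonneg _) hint
    (ae_of_all _ fun g => ?_)).trans ?_
  · simp only [Pi.pow_apply]
    have : 8 * a ^ 2 * v * g ^ 2 = 2 * (2 * a * √v * g) ^ 2 := by
      linear_combination -(8 * a ^ 2 * g ^ 2) * hsq
    nlinarith [sq_nonneg (v * g ^ 2 + 2 * a * √v * g)]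
  · rw [integral_add (i2.const_mul _) (i4.const_mul _), integral_const_mul, integral_const_mul, e2,
      ← hK]
    have : 0 ≤ K * (v * a ^ 2) := by positivity
    have : 0 ≤ (v : ℝ) ^ 2 := by positivity
    nlinarith

theorem integral_distortion_iidLaw {n : ℕ} (hn : n ≠ 0) (x m : Fin n → ℝ) {Q : ℝ} (hQ : 0 ≤ Q) :
    ∫ y, distortion x y ∂iidLaw m Q = Q + distortion x m := by
  have hn' : (n : ℝ) ≠ 0 := by exact_mod_cast hn
  have hcomp : ∀ k : Fin n, ∫ y, (x k - y k) ^ 2 ∂iidLaw m Q = Q + (x k - m k) ^ 2 := fun k => by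
    have := (measurePreserving_eval (fun k => gaussianReal (m k) Q.toNNReal) k).hasLaw.integral_comp
      (f := fun y : ℝ => (x k - y) ^ 2) (by fun_prop)
    rw [integral_sq_sub_gaussianReal, Real.coe_toNNReal _ hQ] at this
    exact this
  unfold distortion
  rw [integral_div, integral_finsetSum _ fun k _ => ?_]
  · simp only [hcomp, Finset.sum_add_distrib, Finset.sum_const, Finset.card_univ, Fintype.card_fin,
      nsmul_eq_mul]
    field_simp
  · exact ((memLp_sq_sub_gaussianReal (x k) (m k) Q.toNNReal).comp_measurePreserving
      (measurePreserving_eval (fun k => gaussianReal (m k) Q.toNNReal) k)).integrable (by norm_num)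

theorem memLp_distortion_iidLaw {n : ℕ} (x m : Fin n → ℝ) (Q : ℝ) :
    MemLp (distortion x) 2 (iidLaw m Q) := by
  have : distortion x = fun y => (n : ℝ)⁻¹ * ∑ k, (x k - y k) ^ 2 := by
    funext y; rw [distortion, div_eq_inv_mul]
  rw [this]
  have hk : ∀ k ∈ Finset.univ, MemLp (fun y : Fin n → ℝ => (x k - y k) ^ 2) 2 (iidLaw m Q) :=
    fun k _ => (memLp_sq_sub_gaussianReal (x k) (m k) Q.toNNReal).comp_measurePreserving
      (measurePreserving_eval (fun k => gaussianReal (m k) Q.toNNReal) k)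
  exact (memLp_finsetSum Finset.univ hk).const_mul _

theorem exists_variance_distortion_le : ∃ C : ℝ, 0 ≤ C ∧ ∀ (n : ℕ), n ≠ 0 →
    ∀ (x m : Fin n → ℝ) (Q : ℝ), 0 ≤ Q →
      Var[distortion x; iidLaw m Q] ≤ C * (Q ^ 2 + Q * distortion x m) / n := by
  obtain ⟨C, hC, h⟩ := exists_variance_sq_sub_le
  refine ⟨C, hC, fun n hn x m Q hQ => ?_⟩
  have hn' : (n : ℝ) ≠ 0 := by exact_mod_cast hn
  have hd : distortion x = fun y => (n : ℝ)⁻¹ * (∑ k, fun y : Fin n → ℝ => (x k - y k) ^ 2) y := by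
    funext y; rw [distortion, div_eq_inv_mul, Finset.sum_apply]
  have hsum := variance_sum_pi (μ := fun k => gaussianReal (m k) Q.toNNReal)
    (X := fun k y => (x k - y) ^ 2) fun k => memLp_sq_sub_gaussianReal (x k) (m k) Q.toNNReal
  have hdm : distortion x m = (∑ k, (x k - m k) ^ 2) / n := rfl
  rw [hdm, hd, variance_const_mul]
  unfold iidLaw
  rw [hsum]
  have hle : ∑ k, Var[fun y => (x k - y) ^ 2; gaussianReal (m k) Q.toNNReal]
      ≤ ∑ k, C * (Q ^ 2 + Q * (x k - m k) ^ 2) := Finset.sum_le_sum fun k _ => by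
    have := h (x k) (m k) Q.toNNReal
    rwa [Real.coe_toNNReal _ hQ] at this
  refine (mul_le_mul_of_nonneg_left hle (by positivity)).trans_eq ?_
  rw [← Finset.mul_sum, Finset.sum_add_distrib, ← Finset.mul_sum]
  simp only [Finset.sum_const, Finset.card_univ, Fintype.card_fin, nsmul_eq_mul]
  field_simp

/-- Weak law of large numbers for the distortion between a fixed vector and a Gaussian one. -/
theorem eventually_half_le_iidLaw {w P δ : ℝ} (hP : 0 ≤ P) (hδ : 0 < δ) :
    ∀ᶠ n : ℕ in atTop, ∀ (x m : Fin n → ℝ) (Q : ℝ), 0 ≤ Q → Q ≤ P → distortion x m ≤ w →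
      ENNReal.ofReal (1 / 2) ≤ iidLaw m Q {y | |distortion x y - (Q + distortion x m)| < δ} := by
  obtain ⟨C, hC, h⟩ := exists_variance_distortion_le
  -- Chebyshev's bound at the worst values `Q = P`, `d(x, m) = w` gives one threshold on `n` for all
  -- `x`, `m`, `Q`.
  have hlim : Tendsto (fun n : ℕ => C * (P ^ 2 + P * w) / n / δ ^ 2) atTop (𝓝 0) := by
    simpa using (tendsto_const_div_atTop_nhds_zero_nat (C * (P ^ 2 + P * w))).div_const (δ ^ 2)
  filter_upwards [hlim.eventually_lt_const (show (0 : ℝ) < 1 / 2 by norm_num),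
    eventually_ne_atTop 0] with n hsmall hn x m Q hQ hQP hx
  have hdev := meas_ge_le_variance_div_sq (memLp_distortion_iidLaw x m Q) hδ
  rw [integral_distortion_iidLaw hn x m hQ] at hdev
  have hvar : Var[distortion x; iidLaw m Q] / δ ^ 2 ≤ 1 / 2 := by
    refine le_trans ?_ hsmall.le
    refine div_le_div_of_nonneg_right ((h n hn x m Q hQ).trans ?_) (by positivity)
    have := distortion_nonneg x m
    gcongr
  have hcompl : {y | |distortion x y - (Q + distortion x m)| < δ}ᶜ
      = {y | δ ≤ |distortion x y - (Q + distortion x m)|} := by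
    ext y; simp
  have hmeas : MeasurableSet {y | |distortion x y - (Q + distortion x m)| < δ} :=
    measurableSet_lt (by have := measurable_distortion_right x; fun_prop) measurable_const
  have hadd := prob_add_prob_compl (μ := iidLaw m Q) hmeas
  rw [hcompl] at hadd
  have hle := hdev.trans (ENNReal.ofReal_le_ofReal hvar)
  have h1 : (1 : ENNReal) = ENNReal.ofReal (1 / 2) + ENNReal.ofReal (1 / 2) := by
    rw [← ENNReal.ofReal_add (by norm_num) (by norm_num)]; norm_num
  rw [h1] at hadd
  by_contra hcon
  have := ENNReal.add_lt_add_of_lt_of_le (by finiteness) (not_le.1 hcon) hle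
  exact absurd hadd this.ne

/-- Lower bound for the probability that an i.i.d. Gaussian codeword hits a distortion ball,
uniform in the distance of the two centres. -/
theorem eventually_le_iidLaw_ball {R w P D : ℝ} (hP : 0 < P) (hD : 0 < D)
    (h : Riid w P D < R) :
    ∃ r < R, ∀ᶠ n : ℕ in atTop, ∀ x c : Fin n → ℝ, distortion x c ≤ w →
      ENNReal.ofReal (Real.exp (-(n * r)) * (1 / 2)) ≤ iidLaw c P {y | distortion x y ≤ D} := by
  obtain ⟨δ, hδ, hδD, hr⟩ := exists_slack hP hD h
  have hD' : 0 < D - δ := by linarith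
  refine ⟨_, hr, ?_⟩
  filter_upwards [eventually_half_le_iidLaw hP.le hδ, eventually_ne_atTop 0] with n hhalf hn x c hx
  have hn' : (0 : ℝ) < n := by exact_mod_cast Nat.pos_of_ne_zero hn
  have hd0 := distortion_nonneg x c
  -- The tilt is adapted to the actual distance `d(x, c)`; `w` enters only through monotonicity.
  -- Aiming at `D - δ` keeps the whole shell of half-width `δ` inside the ball.
  set s := sStar (distortion x c) P (D - δ) with hs
  have hs0 : 0 ≤ s := sStar_nonneg _ _ _
  set m : Fin n → ℝ := fun k => x k - (x k - c k) / (1 + 2 * s)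
  have hm : distortion x m = distortion x c / (1 + 2 * s) ^ 2 := by
    unfold distortion
    simp only [m, sub_sub_cancel, div_pow]
    rw [← Finset.sum_div, div_right_comm]
  have hu : 1 ≤ 1 + 2 * s := by linarith
  have hmw : distortion x m ≤ w := by
    rw [hm]; exact (div_le_self hd0 (one_le_pow₀ hu)).trans hx
  have hA := hhalf x m (P / (1 + 2 * s)) (by positivity) (div_le_self hP.le hu) hmw
  set A := {y | |distortion x y - (P / (1 + 2 * s) + distortion x m)| < δ} with hAdef
  have hmeasA : MeasurableSet A :=
    measurableSet_lt (by have := measurable_distortion_right x; fun_prop) measurable_const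
  have hmean : P / (1 + 2 * s) + distortion x m ≤ D - δ := by
    rw [hm]; exact tilted_mean_le hD' hd0
  have hAB : A ⊆ {y | distortion x y ≤ D} := fun y hy => by
    have := (abs_lt.1 (show |_| < δ from hy)).2
    show distortion x y ≤ D
    linarith
  refine le_trans ?_ (measure_mono hAB)
  rw [iidLaw_eq_tilt hs0 hP x c, withDensity_apply _ hmeasA,
    ENNReal.ofReal_mul (Real.exp_pos _).le]
  refine le_trans (mul_le_mul_right hA _) ?_
  rw [← setLIntegral_const]
  refine setLIntegral_mono' hmeasA fun y hy => ?_
  rw [prod_tiltDensity hn]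
  refine ENNReal.ofReal_le_ofReal (Real.exp_le_exp.2 (neg_le_neg
    (mul_le_mul_of_nonneg_left ?_ hn'.le)))
  -- When `s = 0` the shell may lie well below `D - 2δ`, but the factor `s` then removes the
  -- distortion from the density.
  have hlow : s * (D - 2 * δ) ≤ s * distortion x y := by
    rcases hs0.eq_or_lt with h0 | h0
    · rw [← h0]; simp
    · have heq : P / (1 + 2 * s) + distortion x m = D - δ := by
        rw [hm]; exact tilted_mean_eq hD' hd0 h0
      have := (abs_lt.1 (show |_| < δ from hy)).1
      exact mul_le_mul_of_nonneg_left (by linarith) hs0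
  have h1 : Riid (distortion x c) P (D - δ) ≤ Riid w P (D - δ) := Riid_mono hd0 hP hD' hx
  have h2 : s * δ / P ≤ sStar w P (D - δ) * δ / P := by
    have : s ≤ sStar w P (D - δ) := sStar_mono hD' hx
    gcongr
  have h3 : RiidAt s (distortion x c) P (distortion x y)
      ≤ Riid (distortion x c) P (D - δ) + s * δ / P := by
    unfold Riid RiidAt
    rw [← hs]
    have : s * (D - 2 * δ) / P ≤ s * distortion x y / P := by gcongr
    have e : s * (D - 2 * δ) / P = s * (D - δ) / P - s * δ / P := by ring
    linarith
  linarith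

/-- With more than `exp (n R)` independent codewords, all of them miss the distortion ball only with
a probability that decays faster than exponentially. -/
theorem eventually_iidLaw_miss_pow_le {R w P D : ℝ} (hP : 0 < P) (hD : 0 < D)
    (h : Riid w P D < R) (L : ℝ) :
    ∀ᶠ n : ℕ in atTop, ∀ M : ℕ, Real.exp (n * R) ≤ M → ∀ x c : Fin n → ℝ, distortion x c ≤ w →
      iidLaw c P {y | D < distortion x y} ^ M ≤ ENNReal.ofReal (Real.exp (-(n * L))) := by
  obtain ⟨r, hr, hball⟩ := eventually_le_iidLaw_ball hP hD h
  -- The expected number of hits is at least `exp(n(R - r))/2`, and the miss probability is at most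
  -- the exponential of its negative.
  have hgrow : ∀ᶠ n : ℕ in atTop, (n : ℝ) * L ≤ Real.exp (n * (R - r)) * (1 / 2) := by
    have hη : 0 < R - r := by linarith
    have ht : Tendsto (fun n : ℕ => (n : ℝ) * (R - r)) atTop atTop :=
      tendsto_natCast_atTop_atTop.atTop_mul_const hη
    have hdiv := (Real.tendsto_exp_div_pow_atTop 1).comp ht
    filter_upwards [hdiv.eventually_ge_atTop (2 * |L| / (R - r)), eventually_gt_atTop 0]
      with n hn hpos
    have hn' : (0 : ℝ) < n := by exact_mod_cast hpos
    simp only [Function.comp, pow_one] at hn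
    rw [le_div_iff₀ (by positivity)] at hn
    have e : 2 * |L| / (R - r) * (n * (R - r)) = 2 * (n * |L|) := by field_simp
    have : (n : ℝ) * L ≤ n * |L| := mul_le_mul_of_nonneg_left (le_abs_self L) hn'.le
    linarith
  filter_upwards [hball, hgrow] with n hn hL M hM x c hx
  set p := Real.exp (-(n * r)) * (1 / 2) with hp
  have hp0 : 0 ≤ p := by positivity
  have hmeas : MeasurableSet {y | distortion x y ≤ D} :=
    measurableSet_le (measurable_distortion_right x) measurable_const
  have hcompl : {y | D < distortion x y} = {y | distortion x y ≤ D}ᶜ := by ext y; simp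
  have hle : iidLaw c P {y | D < distortion x y} ≤ ENNReal.ofReal (Real.exp (-p)) := by
    rw [hcompl, prob_compl_eq_one_sub hmeas]
    refine (tsub_le_tsub_left (hn x c hx) 1).trans ?_
    rw [← ENNReal.ofReal_one, ← ENNReal.ofReal_sub _ hp0]
    refine ENNReal.ofReal_le_ofReal ?_
    have := Real.add_one_le_exp (-p)
    linarith
  refine (pow_le_pow_left' hle M).trans ?_
  rw [← ENNReal.ofReal_pow (Real.exp_pos _).le, ← Real.exp_nat_mul]
  refine ENNReal.ofReal_le_ofReal (Real.exp_le_exp.2 ?_)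
  have h1 : Real.exp (n * R) * p ≤ M * p := mul_le_mul_of_nonneg_right hM hp0
  have h2 : Real.exp (n * R) * p = Real.exp (n * (R - r)) * (1 / 2) := by
    rw [hp, ← mul_assoc, ← Real.exp_add]; ring_nf
  linarith

/-! ### Excess-distortion probabilities of the random codes -/

instance (n M : ℕ) (P : ℝ) : IsProbabilityMeasure (codebook₁ n M P) := by
  unfold codebook₁; infer_instance

instance {n M₁ : ℕ} (M₂ : ℕ) (P : ℝ) (y : Fin M₁ → Fin n → ℝ) :
    IsProbabilityMeasure (codebook₂ M₂ P y) := by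
  unfold codebook₂; infer_instance

theorem lt_distortion_nearest {n M : ℕ} [NeZero M] (D : ℝ) (x : Fin n → ℝ) (c : Fin M → Fin n → ℝ) :
    D < distortion x (c (nearest x c)) ↔ ∀ j, D < distortion x (c j) := by
  have hmem : nearest x c ∈ argminSet x c := Finset.min'_mem _ _
  simp only [argminSet, Finset.mem_filter, Finset.mem_univ, true_and] at hmem
  exact ⟨fun h j => h.trans_le (hmem j), fun h => h _⟩

theorem pi_iidLaw_miss {n : ℕ} (M : ℕ) (D P : ℝ) (x c : Fin n → ℝ) :
    (Measure.pi fun _ : Fin M => iidLaw c P) {z | ∀ j, D < distortion x (z j)}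
      = iidLaw c P {y | D < distortion x y} ^ M := by
  have : {z : Fin M → Fin n → ℝ | ∀ j, D < distortion x (z j)}
      = Set.univ.pi fun _ => {y | D < distortion x y} := by
    ext z; simp
  rw [this, Measure.pi_pi]
  simp

theorem codebook₁_dec₁ {n M : ℕ} [NeZero M] (D P : ℝ) (x : Fin n → ℝ) :
    codebook₁ n M P {y | D < distortion x (dec₁ x y)} = iidLaw 0 P {y | D < distortion x y} ^ M := by
  simp only [dec₁, enc₁, lt_distortion_nearest]
  exact pi_iidLaw_miss M D P x 0

/-- The first index is a function of `x` and `y` alone, so given them only the marginal of the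
selected sub-codebook matters. -/
theorem codebook₂_dec₂ {n M₁ M₂ : ℕ} [NeZero M₁] [NeZero M₂] (D P : ℝ) (x : Fin n → ℝ)
    (y : Fin M₁ → Fin n → ℝ) :
    codebook₂ M₂ P y {z | D < distortion x (dec₂ x y z)}
      = iidLaw (dec₁ x y) P {z | D < distortion x z} ^ M₂ := by
  simp only [dec₂, enc₂, lt_distortion_nearest]
  rw [← pi_iidLaw_miss]
  have hmeas : MeasurableSet {z : Fin M₂ → Fin n → ℝ | ∀ j, D < distortion x (z j)} := by
    have : {z : Fin M₂ → Fin n → ℝ | ∀ j, D < distortion x (z j)}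
        = Set.univ.pi fun _ => {y | D < distortion x y} := by
      ext z; simp
    rw [this]
    exact MeasurableSet.univ_pi fun _ =>
      measurableSet_lt measurable_const (measurable_distortion_right x)
  exact (measurePreserving_eval (fun i => Measure.pi fun _ : Fin M₂ => iidLaw (y i) P)
    (enc₁ x y)).measure_preimage hmeas.nullMeasurableSet

/-- The union bound in integral form. Neither `f` nor `S` has to be measurable, so measurability of
the encoders never has to be checked. -/
theorem lintegral_le_add_measure {Ω : Type*} [MeasurableSpace Ω] (μ : Measure Ω)
    [IsProbabilityMeasure μ] {f : Ω → ENNReal} {S : Set Ω} {b : ENNReal} (h1 : ∀ ω, f ω ≤ 1)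
    (hS : ∀ ω, ω ∉ S → f ω ≤ b) : ∫⁻ ω, f ω ∂μ ≤ b + μ S := by
  calc ∫⁻ ω, f ω ∂μ ≤ ∫⁻ ω, b + S.indicator 1 ω ∂μ := by
        refine lintegral_mono fun ω => ?_
        by_cases hω : ω ∈ S
        · simpa [hω] using (h1 ω).trans le_add_self
        · simpa [hω] using hS ω hω
    _ = b + ∫⁻ ω, S.indicator 1 ω ∂μ := by
        rw [lintegral_add_left measurable_const]; simp
    _ ≤ b + μ S := by gcongr; exact lintegral_indicator_one_le S

theorem lintegral_codebook₂_le_one {n M₁ M₂ : ℕ} (PY PZ : ℝ)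
    (A : (Fin M₁ → Fin n → ℝ) → Set (Fin M₁ → Fin M₂ → Fin n → ℝ)) :
    ∫⁻ y, codebook₂ M₂ PZ y (A y) ∂(codebook₁ n M₁ PY) ≤ 1 := by
  refine (lintegral_mono fun y => prob_le_one).trans ?_
  simp

theorem ensemblePr_le_one (PX : Measure ℝ) [IsProbabilityMeasure PX] (n M₁ M₂ : ℕ) (PY PZ : ℝ)
    (A : Set ((Fin n → ℝ) × (Fin M₁ → Fin n → ℝ) × (Fin M₁ → Fin M₂ → Fin n → ℝ))) :
    ensemblePr PX n M₁ M₂ PY PZ A ≤ 1 := by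
  unfold ensemblePr
  refine (lintegral_mono fun x => lintegral_codebook₂_le_one PY PZ _).trans ?_
  simp

theorem excessPr₁_le (PX : Measure ℝ) [IsProbabilityMeasure PX] {PY PZ D w : ℝ} {n M₁ M₂ : ℕ}
    [NeZero M₁] {b : ENNReal}
    (hb : ∀ x : Fin n → ℝ, distortion x 0 ≤ w → iidLaw 0 PY {y | D < distortion x y} ^ M₁ ≤ b) :
    excessPr₁ PX PY PZ D n M₁ M₂
      ≤ b + (Measure.pi fun _ : Fin n => PX) {x | w < distortion x 0} := by
  unfold excessPr₁ ensemblePr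
  refine lintegral_le_add_measure _ (fun x => lintegral_codebook₂_le_one PY PZ _) fun x hx => ?_
  -- The event does not involve `z`, so off `S` its conditional probability is zero and `b = 0`
  -- works.
  have := lintegral_le_add_measure (codebook₁ n M₁ PY) (b := 0)
    (S := {y | D < distortion x (dec₁ x y)})
    (f := fun y => codebook₂ M₂ PZ y {z | D < distortion x (dec₁ x y)})
    (fun y => prob_le_one) fun y hy => by
      rw [Set.mem_ofPred_eq] at hy
      simp [hy]
  rw [zero_add, codebook₁_dec₁] at this
  exact this.trans (hb x (not_lt.1 hx))

/-- Three ways to fail: source power above `w`, first layer farther than `γ`, or second layer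
missing from a centre within `γ`. The threshold `γ` is unrelated to the first decoder's target. -/
theorem excessPr₂_le (PX : Measure ℝ) [IsProbabilityMeasure PX] {PY PZ D γ w : ℝ} {n M₁ M₂ : ℕ}
    [NeZero M₁] [NeZero M₂] {b : ENNReal}
    (hb : ∀ x : Fin n → ℝ, distortion x 0 ≤ w → iidLaw 0 PY {y | γ < distortion x y} ^ M₁ ≤ b)
    (hb' : ∀ x c : Fin n → ℝ, distortion x c ≤ γ → iidLaw c PZ {z | D < distortion x z} ^ M₂ ≤ b) :
    excessPr₂ PX PY PZ D n M₁ M₂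
      ≤ (b + b) + (Measure.pi fun _ : Fin n => PX) {x | w < distortion x 0} := by
  unfold excessPr₂ ensemblePr
  refine lintegral_le_add_measure _ (fun x => lintegral_codebook₂_le_one PY PZ _) fun x hx => ?_
  refine (lintegral_le_add_measure (codebook₁ n M₁ PY) (b := b)
    (S := {y | γ < distortion x (dec₁ x y)}) (fun y => prob_le_one) fun y hy => ?_).trans ?_
  · exact (codebook₂_dec₂ D PZ x y).le.trans (hb' x _ (not_lt.1 hy))
  · rw [codebook₁_dec₁]
    gcongr
    exact hb x (not_lt.1 hx)

/-! ### Large deviations of the source power -/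

/-- Chernoff's bound: Markov's inequality for `∏ exp(θ x_k²)`, valid also when the moment generating
function is infinite. -/
theorem pi_lt_distortion_le (PX : Measure ℝ) [IsProbabilityMeasure PX] {θ : ℝ} (hθ : 0 ≤ θ) (w : ℝ)
    {n : ℕ} (hn : n ≠ 0) :
    (Measure.pi fun _ : Fin n => PX) {x | w < distortion x 0}
      ≤ ENNReal.ofReal (Real.exp (-(n * (θ * w))))
        * (∫⁻ a, ENNReal.ofReal (Real.exp (θ * a ^ 2)) ∂PX) ^ n := by
  have hn' : (n : ℝ) ≠ 0 := by exact_mod_cast hn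
  have hmeas : Measurable fun a : ℝ => ENNReal.ofReal (Real.exp (θ * a ^ 2)) := by fun_prop
  have hprod : ∀ x : Fin n → ℝ, ∏ k, ENNReal.ofReal (Real.exp (θ * x k ^ 2))
      = ENNReal.ofReal (Real.exp (n * (θ * distortion x 0))) := fun x => by
    rw [← ENNReal.ofReal_prod_of_nonneg fun k _ => (Real.exp_pos _).le, ← Real.exp_sum,
      ← Finset.mul_sum]
    congr 2
    simp only [distortion, Pi.zero_apply, sub_zero]
    field_simp
  have hmarkov := mul_meas_ge_le_lintegral (μ := Measure.pi fun _ : Fin n => PX)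
    (f := fun x : Fin n → ℝ => ∏ k, ENNReal.ofReal (Real.exp (θ * x k ^ 2)))
    (by fun_prop) (ENNReal.ofReal (Real.exp (n * (θ * w))))
  rw [lintegral_pi_prod (fun _ : Fin n => PX) fun _ => hmeas] at hmarkov
  simp only [Finset.prod_const, Finset.card_univ, Fintype.card_fin] at hmarkov
  have hinv : ENNReal.ofReal (Real.exp (-(n * (θ * w))))
      * ENNReal.ofReal (Real.exp (n * (θ * w))) = 1 := by
    rw [← ENNReal.ofReal_mul (Real.exp_pos _).le, ← Real.exp_add]; simp
  refine le_trans ?_ (mul_le_mul_right hmarkov (ENNReal.ofReal (Real.exp (-(n * (θ * w))))))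
  rw [← mul_assoc, hinv, one_mul]
  refine measure_mono fun x hx => ?_
  simp only [Set.mem_ofPred_eq] at hx ⊢
  rw [hprod]
  gcongr

theorem exists_eventually_source_tail (PX : Measure ℝ) [IsProbabilityMeasure PX] {α E : ℝ}
    (hα : 0 < α) (hE : (E : EReal) < rateFn PX (fun x => x ^ 2) α) :
    ∃ w L : ℝ, 0 ≤ w ∧ w < α ∧ E < L ∧ ∀ᶠ n : ℕ in atTop,
      (Measure.pi fun _ : Fin n => PX) {x | w < distortion x 0}
        ≤ ENNReal.ofReal (Real.exp (-(n * L))) := by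
  unfold rateFn at hE
  obtain ⟨θ, hE⟩ := lt_iSup_iff.1 hE
  obtain ⟨hθ, hE⟩ := lt_iSup_iff.1 hE
  set I := ∫⁻ a, ENNReal.ofReal (Real.exp (θ * a ^ 2)) ∂PX with hI
  have hc : cumulant PX (fun x => x ^ 2) θ = ENNReal.log I := rfl
  have h1 : 1 ≤ I := by
    calc (1 : ENNReal) = ∫⁻ _, 1 ∂PX := by simp
      _ ≤ I := lintegral_mono fun a => by
        rw [← ENNReal.ofReal_one]
        exact ENNReal.ofReal_le_ofReal (Real.one_le_exp (by positivity))
  -- An infinite moment generating function would make this term of the supremum `-∞`, which exceeds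
  -- no real `E`.
  have htop : I ≠ ⊤ := fun h => by
    rw [hc, h, ENNReal.log_top, EReal.sub_top] at hE
    exact not_lt_bot hE
  have h0 : I ≠ 0 := (zero_lt_one.trans_le h1).ne'
  set l := Real.log I.toReal
  have hIl : I = ENNReal.ofReal (Real.exp l) := by
    rw [Real.exp_log (ENNReal.toReal_pos h0 htop), ENNReal.ofReal_toReal htop]
  rw [hc, ENNReal.log_pos_real h0 htop, ← EReal.coe_sub, EReal.coe_lt_coe_iff] at hE
  -- The strict inequality at `α` persists slightly to the left; a threshold below `α` is needed for
  -- `R_iid(w) < R`.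
  have hcont : ContinuousAt (fun w : ℝ => θ * w - l) α := by fun_prop
  have hev : ∀ᶠ w in 𝓝[<] α, E < θ * w - l :=
    (hcont.eventually (lt_mem_nhds hE)).filter_mono nhdsWithin_le_nhds
  have hpos : ∀ᶠ w in 𝓝[<] α, 0 < w := (lt_mem_nhds hα).filter_mono nhdsWithin_le_nhds
  obtain ⟨w, hw, hw0, hwα⟩ :=
    (hev.and (hpos.and (self_mem_nhdsWithin (s := Set.Iio α)))).exists
  refine ⟨w, θ * w - l, hw0.le, hwα, hw, ?_⟩
  filter_upwards [eventually_ne_atTop 0] with n hn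
  refine (pi_lt_distortion_le PX hθ w hn).trans_eq ?_
  rw [← hI, hIl, ← ENNReal.ofReal_pow (Real.exp_pos _).le, ← Real.exp_nat_mul,
    ← ENNReal.ofReal_mul (Real.exp_pos _).le, ← Real.exp_add]
  ring_nf

/-- Since `X² ≥ 0`, the cumulant is nonnegative for `θ ≥ 0`. Under the convention `α = 0` only
exponents at most zero are claimed, which any sequence of probabilities attains. -/
theorem rateFn_zero_le (PX : Measure ℝ) [IsProbabilityMeasure PX] :
    rateFn PX (fun x => x ^ 2) 0 ≤ 0 := by
  unfold rateFn
  refine iSup₂_le fun θ hθ => ?_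
  have h1 : (1 : ENNReal) ≤ ∫⁻ a, ENNReal.ofReal (Real.exp (θ * a ^ 2)) ∂PX := by
    calc (1 : ENNReal) = ∫⁻ _, 1 ∂PX := by simp
      _ ≤ _ := lintegral_mono fun a => by
        rw [← ENNReal.ofReal_one]
        exact ENNReal.ofReal_le_ofReal (Real.one_le_exp (by positivity))
  have hc : 0 ≤ cumulant PX (fun x => x ^ 2) θ := ENNReal.zero_le_log_iff.2 h1
  simpa using hc

/-! ### Exponents -/

theorem decayExponent_nonneg {p : ℕ → ENNReal} (hp : ∀ n, p n ≤ 1) : 0 ≤ decayExponent p := by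
  refine le_liminf_of_le (by isBoundedDefault) (Eventually.of_forall fun n => ?_)
  refine EReal.div_nonneg ?_ (by positivity)
  simpa using hp n

/-- The factor `3` leaves room for the union bounds over at most three failure events; the gap `L -
E'` absorbs it. -/
theorem le_decayExponent {p : ℕ → ENNReal} {E : EReal}
    (h : ∀ E' : ℝ, (E' : EReal) < E → ∃ L, E' < L ∧ ∀ᶠ n : ℕ in atTop,
      p n ≤ 3 * ENNReal.ofReal (Real.exp (-(n * L)))) : E ≤ decayExponent p := by
  refine le_of_forall_lt fun c hc => ?_
  obtain ⟨E', hcE, hE⟩ := EReal.lt_iff_exists_real_btwn.1 hc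
  obtain ⟨L, hL, hp⟩ := h E' hE
  refine hcE.trans_le (le_liminf_of_le (by isBoundedDefault) ?_)
  have hbig : ∀ᶠ n : ℕ in atTop, Real.log 3 ≤ n * (L - E') :=
    (tendsto_natCast_atTop_atTop.atTop_mul_const (by linarith)).eventually_ge_atTop _
  filter_upwards [hp, hbig, eventually_gt_atTop 0] with n hn hlog hpos
  have hn' : (0 : ℝ) < n := by exact_mod_cast hpos
  have hpn : p n ≤ ENNReal.ofReal (Real.exp (-(n * E'))) := by
    refine hn.trans ?_
    have h3 : (3 : ENNReal) = ENNReal.ofReal (Real.exp (Real.log 3)) := by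
      rw [Real.exp_log (by norm_num)]; norm_num
    rw [h3, ← ENNReal.ofReal_mul (Real.exp_pos _).le, ← Real.exp_add]
    exact ENNReal.ofReal_le_ofReal (Real.exp_le_exp.2 (by linarith))
  have hlogp : ENNReal.log (p n) ≤ ((-(n * E') : ℝ) : EReal) := by
    refine (ENNReal.log_monotone hpn).trans_eq ?_
    rw [ENNReal.log_ofReal_of_pos (Real.exp_pos _), Real.log_exp]
  have hcast : ((n : ℕ) : EReal) = ((n : ℝ) : EReal) := rfl
  rw [hcast, EReal.le_div_iff_mul_le (by exact_mod_cast hn') (EReal.coe_ne_top _),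
    EReal.le_neg, ← EReal.coe_mul, ← EReal.coe_neg]
  refine hlogp.trans_eq ?_
  rw [mul_comm]

theorem le_decayExponent_excessPr₁ (PX : Measure ℝ) [IsProbabilityMeasure PX]
    {R PY PZ D α : ℝ} {E : EReal} (hR : 0 < R) (hPY : 0 < PY) (hD : 0 < D)
    (hα : IsPowerSolution R PY D α) (hE : E ≤ rateFn PX (fun x => x ^ 2) α) (M₁ M₂ : ℕ → ℕ+)
    (hM : ∀ n : ℕ, Real.exp (n * R) ≤ (M₁ n : ℕ)) :
    E ≤ decayExponent (fun n => excessPr₁ PX PY PZ D n (M₁ n) (M₂ n)) := by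
  rcases hα with ⟨hα0, hRα⟩ | ⟨rfl, -⟩
  · refine le_decayExponent fun E' hE' => ?_
    obtain ⟨w, L, hw0, hwα, hL, htail⟩ :=
      exists_eventually_source_tail PX hα0 (hE'.trans_le hE)
    refine ⟨L, hL, ?_⟩
    filter_upwards [htail, eventually_iidLaw_miss_pow_le hPY hD
      (Riid_lt_of_lt hR hw0 hPY hD hwα hRα) L] with n h1 h2
    refine (excessPr₁_le PX fun x hx => h2 _ (hM n) x 0 hx).trans ((add_le_add_right h1 _).trans ?_)
    rw [← two_mul]
    gcongr
    norm_num
  · exact (hE.trans (rateFn_zero_le PX)).trans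
      (decayExponent_nonneg fun n => ensemblePr_le_one PX _ _ _ _ _ _)

theorem le_decayExponent_excessPr₂ (PX : Measure ℝ) [IsProbabilityMeasure PX]
    {R₁ R₂ PY PZ D γ α : ℝ} {E : EReal} (hR₁ : 0 < R₁) (hR₂ : 0 < R₂) (hPY : 0 < PY) (hPZ : 0 < PZ)
    (hD : 0 < D) (hγ : 0 < γ) (hRγ : R₂ = Riid γ PZ D) (hα : IsPowerSolution R₁ PY γ α)
    (hE : E ≤ rateFn PX (fun x => x ^ 2) α) (M₁ M₂ : ℕ → ℕ+)
    (hM₁ : ∀ n : ℕ, Real.exp (n * R₁) ≤ (M₁ n : ℕ))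
    (hM₂ : ∀ n : ℕ, Real.exp (n * R₂) ≤ (M₂ n : ℕ)) :
    E ≤ decayExponent (fun n => excessPr₂ PX PY PZ D n (M₁ n) (M₂ n)) := by
  rcases hα with ⟨hα0, hRα⟩ | ⟨rfl, -⟩
  · refine le_decayExponent fun E' hE' => ?_
    obtain ⟨w, L, hw0, hwα, hL, htail⟩ :=
      exists_eventually_source_tail PX hα0 (hE'.trans_le hE)
    -- The first layer must come strictly closer than `γ`, because at `γ` itself the second layer
    -- has no rate to spare. The slack in `R₁` pays for this.
    obtain ⟨γ', hγ'0, hγ', hlt⟩ :=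
      exists_lt_distortion hPY hγ (Riid_lt_of_lt hR₁ hw0 hPY hγ hwα hRα)
    refine ⟨L, hL, ?_⟩
    filter_upwards [htail, eventually_iidLaw_miss_pow_le hPY hγ'0 hlt L,
      eventually_iidLaw_miss_pow_le hPZ hD (Riid_lt_of_lt hR₂ hγ'0.le hPZ hD hγ' hRγ) L]
      with n h1 h2 h3
    refine (excessPr₂_le PX (fun x hx => h2 _ (hM₁ n) x 0 hx)
      fun x c hx => h3 _ (hM₂ n) x c hx).trans ((add_le_add_right h1 _).trans_eq ?_)
    ring
  · exact (hE.trans (rateFn_zero_le PX)).trans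
      (decayExponent_nonneg fun n => ensemblePr_le_one PX _ _ _ _ _ _)

/-! ### Codebook sizes -/

/-- The codebook size `⌈exp (n R)⌉`. -/
noncomputable def codebookSize (R : ℝ) (n : ℕ) : ℕ+ :=
  ⟨⌈Real.exp (n * R)⌉₊, Nat.ceil_pos.2 (Real.exp_pos _)⟩

theorem exp_le_codebookSize (R : ℝ) (n : ℕ) : Real.exp (n * R) ≤ (codebookSize R n : ℕ) :=
  Nat.le_ceil _

theorem log_codebookSize_le {R : ℝ} (hR : 0 ≤ R) (n : ℕ) :
    Real.log (codebookSize R n : ℕ) ≤ n * R + Real.log 2 := by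
  have h1 : ((codebookSize R n : ℕ) : ℝ) ≤ Real.exp (n * R) * 2 := by
    have := (Nat.ceil_lt_add_one (Real.exp_pos (n * R)).le).le
    have h1 : 1 ≤ Real.exp (n * R) := Real.one_le_exp (by positivity)
    calc ((codebookSize R n : ℕ) : ℝ) ≤ Real.exp (n * R) + 1 := this
      _ ≤ _ := by linarith
  have h0 : (0 : ℝ) < (codebookSize R n : ℕ) := by exact_mod_cast (codebookSize R n).pos
  refine (Real.log_le_log h0 h1).trans_eq ?_
  rw [Real.log_mul (Real.exp_pos _).ne' (by norm_num), Real.log_exp]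

theorem limsup_div_le {f : ℕ → ℝ} {R K : ℝ} (h : ∀ n : ℕ, f n ≤ n * R + K) :
    limsup (fun n : ℕ => ((f n / n : ℝ) : EReal)) atTop ≤ (R : EReal) := by
  have hlim : Tendsto (fun n : ℕ => ((R + K / n : ℝ) : EReal)) atTop (𝓝 (R : EReal)) := by
    refine (continuous_coe_real_ereal.tendsto R).comp ?_
    simpa using (tendsto_const_div_atTop_nhds_zero_nat K).const_add R
  rw [← hlim.limsup_eq]
  refine limsup_le_limsup ?_ (by isBoundedDefault) (by isBoundedDefault)
  filter_upwards [eventually_gt_atTop 0] with n hn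
  have hn' : (0 : ℝ) < n := by exact_mod_cast hn
  rw [EReal.coe_le_coe_iff, div_le_iff₀ hn']
  refine (h n).trans_eq ?_
  field_simp

/-- Superposition coding: the second layer succeeds as soon as the first one gets within
distortion `γ`. -/
theorem exponentsUpTo_subset_exponentRegion (PX : Measure ℝ) [IsProbabilityMeasure PX]
    {σ lam D₁ D₂ R₁ R₂ γ α₁ α₂ : ℝ} (hR₁ : 0 < R₁) (hR₂ : 0 < R₂)
    (hPY : 0 < powerY σ lam D₁) (hPZ : 0 < powerZ lam D₁ D₂) (hD₁ : 0 < D₁) (hD₂ : 0 < D₂)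
    (hγ : 0 < γ) (hRγ : R₂ = Riid γ (powerZ lam D₁ D₂) D₂)
    (hα₁ : IsPowerSolution R₁ (powerY σ lam D₁) D₁ α₁)
    (hα₂ : IsPowerSolution R₁ (powerY σ lam D₁) γ α₂) :
    exponentsUpTo PX α₁ α₂ ⊆ exponentRegion PX σ lam D₁ D₂ R₁ R₂ := by
  rintro E ⟨h1, h2, hE1, hE2⟩
  refine subset_closure (subset_convexHull ℝ _
    ⟨h1, h2, codebookSize R₁, codebookSize R₂, ?_, ?_, ?_, ?_⟩)
  · exact limsup_div_le (log_codebookSize_le hR₁.le)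
  · refine limsup_div_le (K := Real.log 2 + Real.log 2) fun n => ?_
    rw [Real.log_mul (by simp) (by simp)]
    linarith [log_codebookSize_le hR₁.le n, log_codebookSize_le hR₂.le n]
  · exact le_decayExponent_excessPr₁ PX hR₁ hPY hD₁ hα₁ hE1 _ _ (exp_le_codebookSize R₁)
  · exact le_decayExponent_excessPr₂ PX hR₁ hR₂ hPY hPZ hD₂ hγ hRγ hα₂ hE2 _ _
      (exp_le_codebookSize R₁) (exp_le_codebookSize R₂)

end SuccRef

theorem theorem7 (PX : MeasureTheory.Measure ℝ) [MeasureTheory.IsProbabilityMeasure PX]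
    (σ D₁ D₂ R₁ R₂ : ℝ)
    (hint : MeasureTheory.Integrable (fun x : ℝ => x ^ 2) PX)
    (hσ : ∫ x, x ^ 2 ∂PX = σ ^ 2)
    (hD₂ : 0 < D₂) (hD₂₁ : D₂ < D₁) (hD₁ : D₁ < σ ^ 2)
    (hR₁ : 0 < R₁) (hR₂ : 0 < R₂)
    (lam PY PZ : ℝ)
    (hlam : lam = SuccRef.designParam D₁ D₂ R₂)
    (hPY : PY = SuccRef.powerY σ lam D₁)
    (hPZ : PZ = SuccRef.powerZ lam D₁ D₂)
    (α₁ : ℝ) (hα₁ : SuccRef.IsPowerSolution R₁ PY D₁ α₁) :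
    (R₂ ≤ 1 / 2 * Real.log (D₁ / D₂) →
      ∀ α₂ : ℝ, SuccRef.IsPowerSolution R₁ PY (lam * D₁) α₂ →
        SuccRef.exponentsUpTo PX α₁ α₂ ⊆ SuccRef.exponentRegion PX σ lam D₁ D₂ R₁ R₂) ∧
    (1 / 2 * Real.log (D₁ / D₂) < R₂ →
      ∀ γ : ℝ, 0 < γ → R₂ = SuccRef.Riid γ PZ D₂ →
        ∀ α₂ : ℝ, SuccRef.IsPowerSolution R₁ PY γ α₂ →
          SuccRef.exponentsUpTo PX α₁ α₂ ⊆ SuccRef.exponentRegion PX σ lam D₁ D₂ R₁ R₂) := by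
  subst hlam hPY hPZ
  have hD₁0 : 0 < D₁ := hD₂.trans hD₂₁
  have hPY : 0 < SuccRef.powerY σ (SuccRef.designParam D₁ D₂ R₂) D₁ := by
    have : SuccRef.designParam D₁ D₂ R₂ * D₁ ≤ 1 * D₁ :=
      mul_le_mul_of_nonneg_right (min_le_right _ _) hD₁0.le
    unfold SuccRef.powerY
    linarith
  have hlog : 1 / 2 * Real.log (D₁ / D₂) < R₂ ↔ D₁ / D₂ < Real.exp (2 * R₂) := by
    rw [← Real.log_lt_iff_lt_exp (by positivity)]
    constructor <;> intro h <;> linarith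
  constructor
  · intro hR α₂ hα₂
    have hle : D₂ * Real.exp (2 * R₂) / D₁ ≤ 1 := by
      have := not_lt.1 (mt hlog.2 (not_lt.2 hR))
      rw [le_div_iff₀ hD₂] at this
      rw [div_le_one hD₁0]
      linarith
    have hmul : SuccRef.designParam D₁ D₂ R₂ * D₁ = D₂ * Real.exp (2 * R₂) := by
      rw [SuccRef.designParam, min_eq_left hle, div_mul_cancel₀ _ hD₁0.ne']
    -- In case (i) `λ D₁ = P_Z + D₂ = D₂ exp(2R₂)`, so `γ = λ D₁` satisfies `R₂ = R_iid(γ, P_Z, D₂)`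
    -- by `Riid_add_self`.
    have hadd : SuccRef.powerZ (SuccRef.designParam D₁ D₂ R₂) D₁ D₂ + D₂
        = D₂ * Real.exp (2 * R₂) := by
      rw [SuccRef.powerZ, hmul, sub_add_cancel]
    have hPZ : 0 < SuccRef.powerZ (SuccRef.designParam D₁ D₂ R₂) D₁ D₂ := by
      have : D₂ * 1 < D₂ * Real.exp (2 * R₂) :=
        mul_lt_mul_of_pos_left (Real.one_lt_exp_iff.2 (by linarith)) hD₂
      linarith
    refine SuccRef.exponentsUpTo_subset_exponentRegion PX hR₁ hR₂ hPY hPZ hD₁0 hD₂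
      (by rw [hmul]; positivity) ?_ hα₁ hα₂
    rw [hmul, ← hadd, SuccRef.Riid_add_self hPZ hD₂, hadd, mul_div_cancel_left₀ _ hD₂.ne',
      Real.log_exp]
    ring
  · intro hR γ hγ hRγ α₂ hα₂
    -- In case (ii) `λ = 1`, hence `P_Z = D₁ - D₂ > 0`.
    have hPZ : 0 < SuccRef.powerZ (SuccRef.designParam D₁ D₂ R₂) D₁ D₂ := by
      have hge : 1 ≤ D₂ * Real.exp (2 * R₂) / D₁ := by
        have := hlog.1 hR
        rw [div_lt_iff₀ hD₂] at this
        rw [one_le_div hD₁0]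
        linarith
      rw [SuccRef.designParam, min_eq_right hge, SuccRef.powerZ]
      linarith
    exact SuccRef.exponentsUpTo_subset_exponentRegion PX hR₁ hR₂ hPY hPZ hD₁0 hD₂ hγ hRγ hα₁ hα₂
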